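/- Identify $\mathbb C^4$ with $\mathbb H^2$ by $(z_1,z_2,z_3,z_4)\mapsto(z_1+jz_2,\;z_3+jz_4)$, where $zj=j\bar z$ and scalars act on the right, and consider the twistor fibration $T:\mathbb{CP}^3\to\mathbb{HP}^1$, $v\mathbb C\mapsto v\mathbb H$. At $p=[v]$ let $\mathcal V_p\subset T_p\mathbb{CP}^3$ be the tangent space of the fibre of $T$ (the image of $v\mathbb H$ under the differential of $v\mapsto[v]$), and let $\mathcal H_p$ be the image of the orthogonal complement of $v\mathbb H$, so that $T_p\mathbb{CP}^3=\mathcal H_p\oplus\mathcal V_p$. The nearly Kähler $\mathbf{CP}^3$ is $\mathbb{CP}^3$ with the almost complex structure $J$ that equals the standard one on $\mathcal H$ and minus the standard one on $\mathcal V$. A pseudoholomorphic curve is a nonconstant smooth map $X:M\to\mathbf{CP}^3$ from a connected Riemann surface $M$ whose differential satisfies $dX(i\xi)=J\,dX(\xi)$. It is called vertical if $dX$ takes values in $\mathcal V$ everywhere on $M$, and horizontal if $dX$ takes values in $\mathcal H$ everywhere on $M$. Then there exist a compact connected Riemann surface $M$ and a pseudoholomorphic curve $X:M\to\mathbf{CP}^3$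 which is neither vertical nor horizontal. -/

import Mathlib

open scoped Manifold ContDiff LinearAlgebra.Projectivization

noncomputable section

namespace NearlyKahlerCP3

/-! ## Complex projective 3-space as a manifold -/

/-- `ℂ⁴` with its standard Hermitian inner product. -/
abbrev C4 : Type := EuclideanSpace ℂ (Fin 4)

/-- The model space `ℂ³` of the affine charts. -/
abbrev C3 : Type := Fin 3 → ℂ

/-- The space of complex lines in `ℂ⁴`. -/
abbrev CP3 : Type := ℙ ℂ C4

/-- The quotient topology on projective space. -/
instance : TopologicalSpace CP3 :=
  inferInstanceAs (TopologicalSpace (Quotient (projectivizationSetoid ℂ C4)))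

/-- The affine coordinates `(vₖ / vᵢ)`, `k ≠ i`. -/
def affineCoord (i : Fin 4) (v : C4) : C3 := fun k => v (i.succAbove k) / v i

/-- The vector with `i`-th coordinate `1` and the other coordinates given by `w`. -/
def affineLift (i : Fin 4) (w : C3) : C4 := WithLp.toLp 2 (i.insertNth 1 w)

theorem affineLift_apply_same (i : Fin 4) (w : C3) : affineLift i w i = 1 := by
  simp [affineLift]

theorem affineLift_apply_succAbove (i : Fin 4) (w : C3) (k : Fin 3) :
    affineLift i w (i.succAbove k) = w k := by
  simp [affineLift]

theorem affineLift_ne_zero (i : Fin 4) (w : C3) : affineLift i w ≠ 0 := fun h => by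
  simpa [h] using affineLift_apply_same i w

theorem affineCoord_affineLift (i : Fin 4) (w : C3) : affineCoord i (affineLift i w) = w := by
  funext k
  simp [affineCoord, affineLift_apply_same, affineLift_apply_succAbove]

theorem smul_affineLift_affineCoord (i : Fin 4) (v : C4) (hv : v i ≠ 0) :
    v i • affineLift i (affineCoord i v) = v := by
  ext j
  rcases i.eq_self_or_eq_succAbove j with rfl | ⟨k, rfl⟩
  · simp [affineLift_apply_same]
  · simp only [PiLp.smul_apply, affineLift_apply_succAbove, affineCoord, smul_eq_mul]
    field_simp

theorem affineCoord_smul (i : Fin 4) (a : ℂ) (ha : a ≠ 0) (v : C4) :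
    affineCoord i (a • v) = affineCoord i v := by
  funext k
  simp only [affineCoord, PiLp.smul_apply, smul_eq_mul]
  exact mul_div_mul_left _ _ ha

theorem rep_mk_eq (v : C4) (hv : v ≠ 0) :
    ∃ a : ℂ, a ≠ 0 ∧ (Projectivization.mk ℂ v hv).rep = a • v := by
  obtain ⟨a, ha⟩ := Projectivization.exists_smul_eq_mk_rep ℂ v hv
  exact ⟨a, a.ne_zero, ha.symm⟩

theorem affineCoord_rep_mk (i : Fin 4) (v : C4) (hv : v ≠ 0) :
    affineCoord i (Projectivization.mk ℂ v hv).rep = affineCoord i v := by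
  obtain ⟨a, ha, h⟩ := rep_mk_eq v hv
  rw [h, affineCoord_smul i a ha]

theorem rep_mk_apply_ne_zero_iff (i : Fin 4) (v : C4) (hv : v ≠ 0) :
    (Projectivization.mk ℂ v hv).rep i ≠ 0 ↔ v i ≠ 0 := by
  obtain ⟨a, ha, h⟩ := rep_mk_eq v hv
  simp [h, ha]

theorem isQuotientMap_mk' :
    Topology.IsQuotientMap (Projectivization.mk' ℂ : {v : C4 // v ≠ 0} → CP3) :=
  isQuotientMap_quot_mk

theorem isOpen_affine (i : Fin 4) : IsOpen {p : CP3 | p.rep i ≠ 0} := by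
  rw [← isQuotientMap_mk'.isOpen_preimage]
  have : (Projectivization.mk' ℂ : {v : C4 // v ≠ 0} → CP3) ⁻¹' {p : CP3 | p.rep i ≠ 0}
      = {v : {v : C4 // v ≠ 0} | (v : C4) i ≠ 0} := by
    ext v
    exact rep_mk_apply_ne_zero_iff i v.1 v.2
  rw [this]
  exact isOpen_ne_fun (by fun_prop) continuous_const

theorem contDiff_affineLift {𝕜 : Type*} [NontriviallyNormedField 𝕜] [NormedAlgebra 𝕜 ℂ]
    (i : Fin 4) : ContDiff 𝕜 ω (affineLift i) := by
  refine (contDiff_piLp 2).2 fun j => ?_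
  rcases i.eq_self_or_eq_succAbove j with rfl | ⟨k, rfl⟩
  · simp only [affineLift_apply_same]
    exact contDiff_const
  · simp only [affineLift_apply_succAbove]
    exact contDiff_apply 𝕜 ℂ k

theorem contDiffOn_affineCoord {𝕜 : Type*} [NontriviallyNormedField 𝕜] [NormedAlgebra 𝕜 ℂ]
    (i : Fin 4) : ContDiffOn 𝕜 ω (affineCoord i) {v : C4 | v i ≠ 0} := by
  refine contDiffOn_pi.2 fun k => ?_
  have h : ∀ j : Fin 4, ContDiffOn 𝕜 ω (fun v : C4 => v j) {v : C4 | v i ≠ 0} := fun j =>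
    (contDiff_piLp_apply 2).contDiffOn
  have h' : ContDiffOn 𝕜 ω (fun v : C4 => (v i)⁻¹) {v : C4 | v i ≠ 0} :=
    ContDiffOn.fun_inv (h i) fun v hv => hv
  simpa only [affineCoord, div_eq_mul_inv] using (h (i.succAbove k)).mul h'

/-- The affine chart `[v] ↦ (vₖ / vᵢ)`, `k ≠ i`, on the open set `vᵢ ≠ 0`. -/
def affineChart (i : Fin 4) : OpenPartialHomeomorph CP3 C3 where
  toFun p := affineCoord i p.rep
  invFun w := Projectivization.mk ℂ (affineLift i w) (affineLift_ne_zero i w)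
  source := {p | p.rep i ≠ 0}
  target := Set.univ
  map_source' _ _ := Set.mem_univ _
  map_target' w _ := by
    refine (rep_mk_apply_ne_zero_iff i _ _).2 ?_
    simp [affineLift_apply_same]
  left_inv' p hp := by
    conv_rhs => rw [← p.mk_rep]
    exact (Projectivization.mk_eq_mk_iff' ℂ _ _ _ _).2
      ⟨(p.rep i)⁻¹, (eq_comm.trans (eq_inv_smul_iff₀ hp)).2 (smul_affineLift_affineCoord i _ hp)⟩
  right_inv' w _ := by rw [affineCoord_rep_mk, affineCoord_affineLift]
  open_source := isOpen_affine i
  open_target := isOpen_univ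
  continuousOn_toFun := by
    rw [isQuotientMap_mk'.continuousOn_isOpen_iff (isOpen_affine i)]
    have h : ContinuousOn (fun v : {v : C4 // v ≠ 0} => affineCoord i (v : C4))
        {v | (v : C4) i ≠ 0} :=
      (contDiffOn_affineCoord (𝕜 := ℂ) i).continuousOn.comp continuous_subtype_val.continuousOn
        fun v hv => hv
    refine (h.mono fun v hv => (rep_mk_apply_ne_zero_iff i v.1 v.2).1 hv).congr fun v _ => ?_
    exact affineCoord_rep_mk i v.1 v.2
  continuousOn_invFun := by
    refine Continuous.continuousOn ?_
    exact isQuotientMap_mk'.continuous.comp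
      ((contDiff_affineLift (𝕜 := ℂ) i).continuous.subtype_mk (affineLift_ne_zero i))

theorem exists_rep_apply_ne_zero (p : CP3) : ∃ i, p.rep i ≠ 0 := by
  by_contra! h
  exact p.rep_nonzero (by ext i; exact h i)

/-- Index of the preferred affine chart at `p`. -/
def chartIndex (p : CP3) : Fin 4 := (exists_rep_apply_ne_zero p).choose

theorem rep_chartIndex_ne_zero (p : CP3) : p.rep (chartIndex p) ≠ 0 :=
  (exists_rep_apply_ne_zero p).choose_spec

/-- The standard atlas of projective space. -/
instance : ChartedSpace C3 CP3 where
  atlas := Set.range affineChart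
  chartAt p := affineChart (chartIndex p)
  mem_chart_source := rep_chartIndex_ne_zero
  chart_mem_atlas _ := ⟨_, rfl⟩

/-- The affine charts make projective space a smooth (even real or complex analytic) manifold. -/
instance {𝕜 : Type*} [NontriviallyNormedField 𝕜] [NormedAlgebra 𝕜 ℂ] :
    IsManifold 𝓘(𝕜, C3) ω CP3 := by
  refine isManifold_of_contDiffOn _ _ _ ?_
  rintro _ _ ⟨i, rfl⟩ ⟨j, rfl⟩
  have h : ContDiffOn 𝕜 ω (affineCoord j ∘ affineLift i) {w : C3 | affineLift i w j ≠ 0} :=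
    (contDiffOn_affineCoord j).comp (contDiff_affineLift i).contDiffOn fun w hw => hw
  refine (h.mono ?_).congr ?_
  · rintro w ⟨⟨_, hw⟩, _⟩
    exact (rep_mk_apply_ne_zero_iff j _ (affineLift_ne_zero i w)).1 hw
  · intro w _
    exact affineCoord_rep_mk j _ (affineLift_ne_zero i w)

/-- The projection `v ↦ [v]` (with an irrelevant value at `v = 0`). -/
def proj (v : C4) : CP3 :=
  open Classical in
  if hv : v ≠ 0 then Projectivization.mk ℂ v hv
  else Projectivization.mk ℂ (affineLift 0 0) (affineLift_ne_zero 0 0)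

theorem proj_of_ne_zero (v : C4) (hv : v ≠ 0) : proj v = Projectivization.mk ℂ v hv := dif_pos hv

theorem proj_rep (p : CP3) : proj p.rep = p := by
  rw [proj_of_ne_zero _ p.rep_nonzero, p.mk_rep]

theorem eventually_proj_eq (v : C4) (hv : v ≠ 0) (i : Fin 4) :
    (fun w : C4 => affineCoord i (proj w).rep) =ᶠ[nhds v] affineCoord i := by
  filter_upwards [isOpen_ne.mem_nhds hv] with w hw
  rw [proj_of_ne_zero w hw, affineCoord_rep_mk]

theorem continuousAt_proj (v : C4) (hv : v ≠ 0) : ContinuousAt proj v := by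
  have h : ContinuousOn proj {v : C4 | v ≠ 0} := by
    rw [continuousOn_iff_continuous_domRestrict]
    refine isQuotientMap_mk'.continuous.congr fun w => ?_
    exact (proj_of_ne_zero w.1 w.2).symm
  exact h.continuousAt (isOpen_ne.mem_nhds hv)

theorem hasFDerivAt_affineCoord (i : Fin 4) (v : C4) (hv : v i ≠ 0) :
    HasFDerivAt (affineCoord i) (fderiv ℂ (affineCoord i) v) v := by
  have h := (contDiffOn_affineCoord (𝕜 := ℂ) i).contDiffAt
    ((isOpen_ne_fun (by fun_prop) continuous_const).mem_nhds hv)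
  exact (h.differentiableAt (by simp)).hasFDerivAt

theorem hasMFDerivAt_proj (p : CP3) :
    HasMFDerivAt 𝓘(ℂ, C4) 𝓘(ℂ, C3) proj p.rep
      (fderiv ℂ (affineCoord (chartIndex p)) p.rep : C4 →L[ℂ] C3) := by
  refine ⟨continuousAt_proj _ p.rep_nonzero, ?_⟩
  have h : HasFDerivAt (fun w : C4 => affineCoord (chartIndex p) (proj w).rep)
      (fderiv ℂ (affineCoord (chartIndex p)) p.rep) p.rep :=
    (hasFDerivAt_affineCoord _ _ (rep_chartIndex_ne_zero p)).congr_of_eventuallyEq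
      (eventually_proj_eq _ p.rep_nonzero _)
  have e : (writtenInExtChartAt 𝓘(ℂ, C4) 𝓘(ℂ, C3) p.rep proj : C4 → C3) =
      fun w : C4 => affineCoord (chartIndex p) (proj w).rep := by
    have : chartIndex (proj p.rep) = chartIndex p := by rw [proj_rep]
    rw [← this]
    rfl
  rw [e]
  exact h.hasFDerivWithinAt

/-! ## The twistor splitting and the nearly Kähler almost complex structure -/

/-- Right multiplication by the quaternion `j` on `ℂ⁴ = ℍ²`, where
`(z₁, z₂, z₃, z₄) ↔ (z₁ + j z₂, z₃ + j z₄)` and `z j = j z̄`. -/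
def mulJ (v : C4) : C4 :=
  !₂[-(starRingEnd ℂ) (v 1), (starRingEnd ℂ) (v 0), -(starRingEnd ℂ) (v 3), (starRingEnd ℂ) (v 2)]

/-- The quaternionic line `vℍ = vℂ ⊕ vjℂ`. -/
def quatLine (v : C4) : Submodule ℂ C4 := Submodule.span ℂ {v, mulJ v}

/-- The differential `ℂ⁴ → T_p CP³` of `v ↦ [v]` at a vector representing `p`. -/
def dproj (p : CP3) : C4 →ₗ[ℂ] TangentSpace 𝓘(ℂ, C3) p :=
  (mfderiv 𝓘(ℂ, C4) 𝓘(ℂ, C3) proj p.rep : C4 →L[ℂ] C3).toLinearMap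

theorem dproj_apply (p : CP3) (w : C4) (k : Fin 3) :
    (dproj p w : C3) k = w ((chartIndex p).succAbove k) / p.rep (chartIndex p)
      - p.rep ((chartIndex p).succAbove k) * w (chartIndex p) / p.rep (chartIndex p) ^ 2 := by
  have hv := rep_chartIndex_ne_zero p
  have h1 : (dproj p w : C3) = fderiv ℂ (affineCoord (chartIndex p)) p.rep w :=
    congrArg (fun L : C4 →L[ℂ] C3 => L w) (hasMFDerivAt_proj p).mfderiv
  have h2 := (hasFDerivAt_pi'.1 (hasFDerivAt_affineCoord _ _ hv)) k
  have h3 : ∀ j : Fin 4, HasFDerivAt (fun v : C4 => v j)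
      (EuclideanSpace.proj j : C4 →L[ℂ] ℂ) p.rep := fun j =>
    (EuclideanSpace.proj j : C4 →L[ℂ] ℂ).hasFDerivAt
  have h4 := (h3 ((chartIndex p).succAbove k)).mul
    ((hasDerivAt_inv hv).comp_hasFDerivAt p.rep (h3 (chartIndex p)))
  have h5 := congrArg (fun L : C4 →L[ℂ] ℂ => L w) (h2.unique h4)
  rw [h1]
  refine h5.trans ?_
  simp
  field_simp
  ring

theorem dproj_eq_zero (p : CP3) (w : C4) (hw : dproj p w = 0) : ∃ a : ℂ, w = a • p.rep := by
  have hv := rep_chartIndex_ne_zero p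
  refine ⟨w (chartIndex p) / p.rep (chartIndex p), ?_⟩
  ext j
  rcases (chartIndex p).eq_self_or_eq_succAbove j with rfl | ⟨k, rfl⟩
  · simp only [PiLp.smul_apply, smul_eq_mul]
    field_simp
  · have h : (dproj p w : C3) k = 0 := congrFun (show (dproj p w : C3) = 0 from hw) k
    rw [dproj_apply] at h
    field_simp at h
    simp only [PiLp.smul_apply, smul_eq_mul]
    field_simp
    linear_combination h

theorem dproj_surjective (p : CP3) : Function.Surjective (dproj p) := by
  intro ξ
  have hv := rep_chartIndex_ne_zero p
  refine ⟨WithLp.toLp 2 ((chartIndex p).insertNth 0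
    (p.rep (chartIndex p) • (show C3 from ξ))), ?_⟩
  refine funext fun k => (dproj_apply p _ k).trans ?_
  simp
  field_simp
  rfl

/-- The vertical space: the image of `vℍ`, that is, the tangent space at `p = [v]` of the fibre
through `p` of the twistor fibration `CP³ → HP¹`, `vℂ ↦ vℍ`. -/
def vertical (p : CP3) : Submodule ℂ (TangentSpace 𝓘(ℂ, C3) p) :=
  (quatLine p.rep).map (dproj p)

/-- The horizontal space: the image of the orthogonal complement of `vℍ`, `p = [v]`. -/
def horizontal (p : CP3) : Submodule ℂ (TangentSpace 𝓘(ℂ, C3) p) :=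
  (quatLine p.rep)ᗮ.map (dproj p)

theorem isCompl_vertical_horizontal (p : CP3) : IsCompl (vertical p) (horizontal p) := by
  constructor
  · rw [Submodule.disjoint_def]
    rintro _ ⟨a, ha, rfl⟩ ⟨b, hb, hab⟩
    obtain ⟨c, hc⟩ := dproj_eq_zero p (b - a) (by rw [map_sub, hab, sub_self])
    have hb' : b ∈ quatLine p.rep := by
      have h : c • p.rep ∈ quatLine p.rep :=
        Submodule.smul_mem _ _ (Submodule.subset_span (by simp))
      rw [← hc] at h
      simpa using Submodule.add_mem _ h ha
    have hb0 : b = 0 := Submodule.disjoint_def.1 (Submodule.orthogonal_disjoint _) b hb' hb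
    rw [← hab, hb0, map_zero]
  · rw [codisjoint_iff, vertical, horizontal, ← Submodule.map_sup,
      Submodule.sup_orthogonal_of_hasOrthogonalProjection, Submodule.map_top,
      LinearMap.range_eq_top]
    exact dproj_surjective p

/-- The almost complex structure of the nearly Kähler `CP³`: multiplication by `i` on the
horizontal space and by `-i` on the vertical space. (Relative to a local `Sp(2)`-frame
`(e₁, e₂)`, `p = [e₁]`, the components of `de₁` along `e₂`, `e₂ j` and the conjugate of its
component along `e₁ j` are the forms of type `(1,0)`.) -/
def J (p : CP3) : TangentSpace 𝓘(ℝ, C3) p →ₗ[ℝ] TangentSpace 𝓘(ℝ, C3) p :=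
  let P : C3 →ₗ[ℂ] C3 := (vertical p).projection (horizontal p) (isCompl_vertical_horizontal p)
  let Q : C3 →ₗ[ℂ] C3 :=
    (horizontal p).projection (vertical p) (isCompl_vertical_horizontal p).symm
  (Complex.I • (Q - P)).restrictScalars ℝ

theorem J_of_mem_horizontal (p : CP3) (ξ : C3) (hξ : ξ ∈ horizontal p) :
    (J p ξ : C3) = Complex.I • ξ := by
  have hP : (vertical p).projection (horizontal p) (isCompl_vertical_horizontal p) ξ = (0 : C3) :=
    Submodule.projection_apply_of_mem_right _ hξ
  have hQ : (horizontal p).projection (vertical p) (isCompl_vertical_horizontal p).symm ξ = ξ :=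
    Submodule.projection_apply_of_mem_left _ hξ
  have h : (ξ : C3) - (0 : C3) = ξ := sub_zero _
  exact congrArg (fun η : C3 => Complex.I • η) ((congrArg₂ (fun a b : C3 => a - b) hQ hP).trans h)

theorem J_of_mem_vertical (p : CP3) (ξ : C3) (hξ : ξ ∈ vertical p) :
    (J p ξ : C3) = -(Complex.I • ξ) := by
  have hP : (vertical p).projection (horizontal p) (isCompl_vertical_horizontal p) ξ = ξ :=
    Submodule.projection_apply_of_mem_left _ hξ
  have hQ : (horizontal p).projection (vertical p) (isCompl_vertical_horizontal p).symm ξ =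
      (0 : C3) := Submodule.projection_apply_of_mem_right _ hξ
  have h : Complex.I • ((0 : C3) - ξ) = -(Complex.I • ξ) := by rw [zero_sub, smul_neg]
  exact (congrArg (fun η : C3 => Complex.I • η)
    (congrArg₂ (fun a b : C3 => a - b) hQ hP)).trans h

/-! ## Pseudoholomorphic curves -/

variable {M : Type*} [TopologicalSpace M] [ChartedSpace ℂ M]

/-- A pseudoholomorphic curve in the nearly Kähler `CP³`: a nonconstant smooth map whose
differential commutes with the almost complex structures. (On a Riemann surface, whose charts are
holomorphic, the complex structure of the tangent spaces is multiplication by `i` on `ℂ`.) -/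
structure IsPseudoholomorphicCurve (X : M → CP3) : Prop where
  smooth : ContMDiff 𝓘(ℝ, ℂ) 𝓘(ℝ, C3) ∞ X
  nonconstant : ∃ m m', X m ≠ X m'
  commutes : ∀ (m : M) (ξ : ℂ),
    mfderiv 𝓘(ℝ, ℂ) 𝓘(ℝ, C3) X m (Complex.I * ξ : ℂ) =
      J (X m) (mfderiv 𝓘(ℝ, ℂ) 𝓘(ℝ, C3) X m ξ)

/-- The curve is vertical: the horizontal part of `dX` vanishes identically. -/
def IsVertical (X : M → CP3) : Prop :=
  ∀ (m : M) (ξ : ℂ), mfderiv 𝓘(ℝ, ℂ) 𝓘(ℝ, C3) X m ξ ∈ vertical (X m)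

/-- The curve is horizontal: the vertical part of `dX` vanishes identically. -/
def IsHorizontal (X : M → CP3) : Prop :=
  ∀ (m : M) (ξ : ℂ), mfderiv 𝓘(ℝ, ℂ) 𝓘(ℝ, C3) X m ξ ∈ horizontal (X m)

end NearlyKahlerCP3

end

open scoped Manifold ContDiff LinearAlgebra.Projectivization

noncomputable section

namespace NearlyKahlerCP3

/-! ## The square torus as a Riemann surface -/

/-! An explicit torus works. Left multiplication by the unit quaternions `exp(iy)` and `exp(ix)` on
the two factors of `ℍ²` is a maximal torus of `Sp(2)`, acting on `ℂ⁴` by `diag(exp(iy), exp(-iy),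
exp(ix), exp(-ix))`. The curve is the orbit of `[1, 1, 1, i]`, parametrised by `z = x + iy`.

Its lift `f` satisfies `df(ξ) = ξ h + ξ̄ · ½ f j` with `h` orthogonal to `fℍ` (`hasFDerivAt_lift`,
`liftHorizontal_mem`). The horizontal part of the differential is thus complex linear and the
vertical part conjugate linear. Since `J` is `i` on the horizontal space and `-i` on the vertical
one, this is the pseudoholomorphic equation. Both parts are nonzero: `h ≠ 0`, and `f j` is not a
complex multiple of `f`. Hence the curve is neither vertical nor horizontal.

The remaining work transfers this identity to projective space: charts of the torus are local
inverses of the covering, and the chosen representative of a point is a multiple `a • f` with `a`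
unknown, so every ingredient needs a rescaling rule. -/

instance : Fact (0 < 2 * Real.pi) := ⟨Real.two_pi_pos⟩

/-- The torus `ℂ / (2πℤ + 2πiℤ)`. -/
def SquareTorus : Type := AddCircle (2 * Real.pi) × AddCircle (2 * Real.pi)

namespace SquareTorus

instance : TopologicalSpace SquareTorus :=
  inferInstanceAs (TopologicalSpace (AddCircle (2 * Real.pi) × AddCircle (2 * Real.pi)))

instance : T2Space SquareTorus :=
  inferInstanceAs (T2Space (AddCircle (2 * Real.pi) × AddCircle (2 * Real.pi)))

instance : CompactSpace SquareTorus :=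
  inferInstanceAs (CompactSpace (AddCircle (2 * Real.pi) × AddCircle (2 * Real.pi)))

/-- The universal covering `ℂ → ℂ / (2πℤ + 2πiℤ)`. -/
def mk (z : ℂ) : SquareTorus := ((z.re : AddCircle (2 * Real.pi)), (z.im : AddCircle (2 * Real.pi)))

theorem continuous_mk : Continuous mk :=
  ((AddCircle.continuous_mk' _).comp Complex.continuous_re).prodMk
    ((AddCircle.continuous_mk' _).comp Complex.continuous_im)

theorem mk_surjective : Function.Surjective mk := by
  rintro ⟨a, b⟩
  obtain ⟨x, rfl⟩ := QuotientAddGroup.mk_surjective a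
  obtain ⟨y, rfl⟩ := QuotientAddGroup.mk_surjective b
  exact ⟨⟨x, y⟩, rfl⟩

instance : ConnectedSpace SquareTorus := mk_surjective.connectedSpace continuous_mk

/-- Every point of the torus lies in the domain of a local section of the covering. -/
theorem exists_section (m : SquareTorus) :
    ∃ e : OpenPartialHomeomorph SquareTorus ℂ, (∀ x ∈ e.source, mk (e x) = x) ∧ m ∈ e.source := by
  obtain ⟨z, rfl⟩ := mk_surjective m
  obtain ⟨e₁, h₁, h₁'⟩ := AddCircle.isLocalHomeomorph_coe (2 * Real.pi) z.re
  obtain ⟨e₂, h₂, h₂'⟩ := AddCircle.isLocalHomeomorph_coe (2 * Real.pi) z.im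
  let E : OpenPartialHomeomorph ℂ SquareTorus :=
    Complex.equivRealProdCLM.toHomeomorph.toOpenPartialHomeomorph.trans (e₁.prod e₂)
  have hE : ∀ w, E w = mk w := fun w =>
    Prod.ext (congrFun h₁' w.re).symm (congrFun h₂' w.im).symm
  have hz : z ∈ E.source := ⟨Set.mem_univ _, h₁, h₂⟩
  refine ⟨E.symm, fun x hx => ?_, ?_⟩
  · rw [← hE]
    exact E.right_inv hx
  · rw [← hE]
    exact E.map_source hz

/-- The atlas of all local sections of the covering `ℂ → ℂ / (2πℤ + 2πiℤ)`. -/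
instance : ChartedSpace ℂ SquareTorus where
  atlas := {e | ∀ x ∈ e.source, mk (e x) = x}
  chartAt m := (exists_section m).choose
  mem_chart_source m := (exists_section m).choose_spec.2
  chart_mem_atlas m := (exists_section m).choose_spec.1

theorem mk_symm_apply {e : OpenPartialHomeomorph SquareTorus ℂ} (he : e ∈ atlas ℂ SquareTorus)
    {z : ℂ} (hz : z ∈ e.target) : e.symm z = mk z := by
  have h : mk (e (e.symm z)) = e.symm z := he _ (e.map_target hz)
  rw [← h, e.right_inv hz]

theorem eq_of_coe_eq_of_abs_sub_lt {x y : ℝ}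
    (h : (x : AddCircle (2 * Real.pi)) = y) (hxy : |x - y| < 2 * Real.pi) : x = y := by
  have h0 : ((x - y : ℝ) : AddCircle (2 * Real.pi)) = 0 := by
    rw [AddCircle.coe_sub, h, sub_self]
  obtain ⟨n, hn⟩ := (AddCircle.coe_eq_zero_iff _).1 h0
  have hp := Real.two_pi_pos
  rw [← hn, zsmul_eq_mul, abs_mul, abs_of_pos hp] at hxy
  have h1 : |(n : ℝ)| < 1 := by
    by_contra! h1
    nlinarith
  have h2 : n = 0 := Int.abs_lt_one_iff.1 (by exact_mod_cast h1)
  rw [h2, zero_smul] at hn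
  linarith

theorem eq_of_mk_eq_of_norm_sub_lt {z w : ℂ} (h : mk z = mk w)
    (hzw : ‖z - w‖ < 2 * Real.pi) : z = w :=
  Complex.ext
    (eq_of_coe_eq_of_abs_sub_lt (congrArg Prod.fst h) ((Complex.abs_re_le_norm (z - w)).trans_lt hzw))
    (eq_of_coe_eq_of_abs_sub_lt (congrArg Prod.snd h) ((Complex.abs_im_le_norm (z - w)).trans_lt hzw))

/-- The transition maps of the torus are locally translations. -/
instance : IsManifold 𝓘(ℂ, ℂ) ω SquareTorus := by
  refine isManifold_of_contDiffOn _ _ _ fun e e' he he' => ?_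
  rintro z ⟨hz, -⟩
  refine ContDiffAt.contDiffWithinAt ?_
  change ContDiffAt ℂ ω (fun w => e' (e.symm w)) z
  have hmk : ∀ w ∈ (e.symm ≫ₕ e').source, mk (e' (e.symm w)) = mk w := fun w hw => by
    rw [← mk_symm_apply he hw.1]
    exact he' _ hw.2
  have hc : ContinuousAt (fun w => e' (e.symm w) - w) z :=
    ((e.symm ≫ₕ e').continuousAt hz).sub continuousAt_id
  -- `e' (e.symm w) - w` is continuous and takes values in the lattice, whose nonzero elements have
  -- norm at least `2π`; it is therefore constant near `z`.
  have hev : ∀ᶠ w in nhds z, e' (e.symm w) = w + (e' (e.symm z) - z) := by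
    filter_upwards [(e.symm ≫ₕ e').open_source.mem_nhds hz,
      hc (Metric.ball_mem_nhds _ Real.two_pi_pos)] with w hw hd
    refine eq_of_mk_eq_of_norm_sub_lt ?_ ?_
    · have h1 := hmk w hw
      have h2 := hmk z hz
      rw [h1]
      have hr : ((e' (e.symm z)).re : AddCircle (2 * Real.pi)) = z.re := congrArg Prod.fst h2
      have hi : ((e' (e.symm z)).im : AddCircle (2 * Real.pi)) = z.im := congrArg Prod.snd h2
      refine Prod.ext ?_ ?_
      · change _ = (((w + (e' (e.symm z) - z)).re : ℝ) : AddCircle (2 * Real.pi))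
        simp only [Complex.add_re, Complex.sub_re, AddCircle.coe_add, AddCircle.coe_sub, hr,
          sub_self, add_zero]
        rfl
      · change _ = (((w + (e' (e.symm z) - z)).im : ℝ) : AddCircle (2 * Real.pi))
        simp only [Complex.add_im, Complex.sub_im, AddCircle.coe_add, AddCircle.coe_sub, hi,
          sub_self, add_zero]
        rfl
    · rw [Set.mem_preimage, mem_ball_iff_norm] at hd
      rwa [show e' (e.symm w) - (w + (e' (e.symm z) - z)) =
        e' (e.symm w) - w - (e' (e.symm z) - z) by ring]
  exact (contDiffAt_id.add contDiffAt_const).congr_of_eventuallyEq hev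

end SquareTorus

/-! ### The splitting and `J` in homogeneous coordinates -/

/-- Affine coordinates are homogeneous of degree 0, so their derivative has degree -1 in the base
point. This absorbs the unknown scalar in `rep`. -/
theorem fderiv_affineCoord_smul (i : Fin 4) (v : C4) (hv : v i ≠ 0) (a : ℂ) (ha : a ≠ 0) (w : C4) :
    fderiv ℂ (affineCoord i) (a • v) (a • w) = fderiv ℂ (affineCoord i) v w := by
  have hav : (a • v) i ≠ 0 := by simp [ha, hv]
  have h1 := (hasFDerivAt_affineCoord i _ hav).comp v ((hasFDerivAt_id v).const_smul a)
  have h2 : HasFDerivAt (affineCoord i) _ v := h1.congr_of_eventuallyEq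
    (Filter.Eventually.of_forall fun u => (affineCoord_smul i a ha u).symm)
  rw [h2.fderiv]
  simp

theorem dproj_eq_fderiv (p : CP3) (w : C4) :
    (dproj p w : C3) = fderiv ℂ (affineCoord (chartIndex p)) p.rep w :=
  congrArg (fun L : C4 →L[ℂ] C3 => L w) (hasMFDerivAt_proj p).mfderiv

theorem mulJ_smul (a : ℂ) (v : C4) : mulJ (a • v) = (starRingEnd ℂ) a • mulJ v := by
  ext i
  fin_cases i <;> simp [mulJ]

theorem quatLine_smul (a : ℂ) (ha : a ≠ 0) (v : C4) : quatLine (a • v) = quatLine v := by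
  have ha' : (starRingEnd ℂ) a ≠ 0 := by simpa using ha
  rw [quatLine, quatLine, Submodule.span_insert, Submodule.span_insert, mulJ_smul,
    Submodule.span_singleton_smul_eq (IsUnit.mk0 _ ha),
    Submodule.span_singleton_smul_eq (IsUnit.mk0 _ ha')]

theorem mem_quatLine_self (v : C4) : v ∈ quatLine v := Submodule.subset_span (by simp)

theorem mulJ_mem_quatLine (v : C4) : mulJ v ∈ quatLine v := Submodule.subset_span (by simp)

/-- The kernel of `dproj p` is spanned by `p.rep`, which already lies in the quaternionic line. -/
theorem mem_quatLine_of_dproj_mem_vertical {p : CP3} {w : C4} (h : dproj p w ∈ vertical p) :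
    w ∈ quatLine p.rep := by
  obtain ⟨q, hq, hqw⟩ := h
  obtain ⟨c, hc⟩ := dproj_eq_zero p (w - q) (by rw [map_sub, hqw, sub_self])
  rw [← sub_add_cancel w q, hc]
  exact Submodule.add_mem _ (Submodule.smul_mem _ _ (mem_quatLine_self _)) hq

theorem J_dproj_add (p : CP3) {h v : C4} (hh : h ∈ (quatLine p.rep)ᗮ) (hv : v ∈ quatLine p.rep) :
    (J p (dproj p (h + v)) : C3) = dproj p (Complex.I • h - Complex.I • v) := by
  have h1 : (J p (dproj p h) : C3) = Complex.I • (dproj p h : C3) :=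
    J_of_mem_horizontal p _ ⟨h, hh, rfl⟩
  have h2 : (J p (dproj p v) : C3) = -(Complex.I • (dproj p v : C3)) :=
    J_of_mem_vertical p _ ⟨v, hv, rfl⟩
  have h3 : (J p (dproj p (h + v)) : C3) = (J p (dproj p h) : C3) + (J p (dproj p v) : C3) :=
    (congrArg (J p) (map_add (dproj p) h v)).trans (map_add (J p) _ _)
  have h4 : (dproj p (Complex.I • h - Complex.I • v) : C3) =
      Complex.I • (dproj p h : C3) - Complex.I • (dproj p v : C3) := by
    rw [map_sub, map_smul, map_smul]
  rw [h3, h1, h2, h4]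
  exact (sub_eq_add_neg (Complex.I • (dproj p h : C3)) _).symm

/-! ## The lift of the curve to `ℂ⁴` -/

/-- The curve `x + iy ↦ (exp(iy), exp(-iy), exp(ix), i exp(-ix))`. -/
def lift (z : ℂ) : C4 :=
  !₂[Complex.exp (Complex.I * z.im), Complex.exp (-(Complex.I * z.im)),
    Complex.exp (Complex.I * z.re), Complex.I * Complex.exp (-(Complex.I * z.re))]

/-- The horizontal part of the derivative of `lift` along the real axis. -/
def liftHorizontal (z : ℂ) : C4 :=
  (1 / 2 : ℂ) • !₂[Complex.exp (Complex.I * z.im), -Complex.exp (-(Complex.I * z.im)),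
    Complex.I * Complex.exp (Complex.I * z.re), Complex.exp (-(Complex.I * z.re))]

theorem lift_apply_ne_zero (z : ℂ) (i : Fin 4) : lift z i ≠ 0 := by
  fin_cases i <;> simp [lift, Complex.exp_ne_zero]

theorem lift_ne_zero (z : ℂ) : lift z ≠ 0 := fun h => lift_apply_ne_zero z 0 (by simp [h])

theorem conj_exp_I_mul (x : ℝ) :
    (starRingEnd ℂ) (Complex.exp (Complex.I * x)) = Complex.exp (-(Complex.I * x)) := by
  rw [← Complex.exp_conj]
  simp

theorem conj_exp_neg_I_mul (x : ℝ) :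
    (starRingEnd ℂ) (Complex.exp (-(Complex.I * x))) = Complex.exp (Complex.I * x) := by
  rw [← Complex.exp_conj]
  simp

theorem mulJ_lift (z : ℂ) : mulJ (lift z) =
    !₂[-Complex.exp (Complex.I * z.im), Complex.exp (-(Complex.I * z.im)),
      Complex.I * Complex.exp (Complex.I * z.re), Complex.exp (-(Complex.I * z.re))] := by
  ext i
  fin_cases i <;> simp [mulJ, lift, conj_exp_I_mul, conj_exp_neg_I_mul]

theorem exp_neg_mul_exp (w : ℂ) : Complex.exp (-w) * Complex.exp w = 1 := by
  rw [← Complex.exp_add, neg_add_cancel, Complex.exp_zero]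

/-- Up to the factor `1/2`, the coordinatewise products sum to `1 - 1 + i - i` against `lift z`, and
to `-1 - 1 + 1 + 1` against `mulJ (lift z)`. -/
theorem liftHorizontal_mem (z : ℂ) : liftHorizontal z ∈ (quatLine (lift z))ᗮ := by
  have hx := exp_neg_mul_exp (Complex.I * z.re)
  have hy := exp_neg_mul_exp (Complex.I * z.im)
  rw [quatLine, Submodule.mem_orthogonal]
  intro u hu
  induction hu using Submodule.span_induction with
  | mem u hu =>
    rcases hu with rfl | rfl
    · simp [PiLp.inner_apply, Fin.sum_univ_four, lift, liftHorizontal, conj_exp_I_mul,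
        conj_exp_neg_I_mul]
      ring
    · rw [mulJ_lift]
      simp [PiLp.inner_apply, Fin.sum_univ_four, liftHorizontal, conj_exp_I_mul,
        conj_exp_neg_I_mul]
      linear_combination hx - hy - (1 / 2) * Complex.exp (Complex.I * z.re) *
        Complex.exp (-(Complex.I * z.re)) * Complex.I_sq
  | zero => simp
  | add u v _ _ hu hv => rw [inner_add_left, hu, hv, add_zero]
  | smul a u _ hu => rw [inner_smul_left, hu, mul_zero]

/-- The real derivative of `lift`. -/
def liftDeriv (z : ℂ) : ℂ →L[ℝ] C4 :=
  (ContinuousLinearMap.id ℝ ℂ).smulRight (liftHorizontal z) +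
    (Complex.conjCLE : ℂ →L[ℝ] ℂ).smulRight ((1 / 2 : ℂ) • mulJ (lift z))

theorem liftDeriv_apply (z ξ : ℂ) : liftDeriv z ξ =
    ξ • liftHorizontal z + (starRingEnd ℂ) ξ • (1 / 2 : ℂ) • mulJ (lift z) := by
  simp [liftDeriv]

/-- The two terms are the Wirtinger derivatives `½(∂x - i∂y)` and `½(∂x + i∂y)`. The factor `i` in
the last coordinate of `lift` is forced: with `c` in its place, the second term equals `½ mulJ (lift
z)` only for `c = i`. -/
theorem hasFDerivAt_lift (z : ℂ) : HasFDerivAt lift (liftDeriv z) z := by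
  have hr : HasStrictFDerivAt (fun z : ℂ => (z.re : ℂ)) (Complex.ofRealCLM.comp Complex.reCLM) z :=
    (Complex.ofRealCLM.comp Complex.reCLM).hasStrictFDerivAt
  have hi : HasStrictFDerivAt (fun z : ℂ => (z.im : ℂ)) (Complex.ofRealCLM.comp Complex.imCLM) z :=
    (Complex.ofRealCLM.comp Complex.imCLM).hasStrictFDerivAt
  have hconj : ∀ ξ : ℂ, (starRingEnd ℂ) ξ = ξ.re - ξ.im * Complex.I := fun ξ =>
    Complex.ext (by simp) (by simp)
  suffices h : HasStrictFDerivAt lift (liftDeriv z) z from h.hasFDerivAt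
  refine (hasStrictFDerivAt_piLp 2).2 fun j => ?_
  fin_cases j
  · refine (hi.const_mul Complex.I).cexp.congr_fderiv (ContinuousLinearMap.ext fun ξ => ?_)
    have hξ := Complex.re_add_im ξ
    simp [liftDeriv_apply, liftHorizontal, mulJ_lift, hconj]
    linear_combination (1 / 2) * Complex.exp (Complex.I * z.im) * hξ
  · refine (hi.const_mul Complex.I).neg.cexp.congr_fderiv (ContinuousLinearMap.ext fun ξ => ?_)
    have hξ := Complex.re_add_im ξ
    simp [liftDeriv_apply, liftHorizontal, mulJ_lift, hconj]
    linear_combination (-1 / 2) * Complex.exp (-(Complex.I * z.im)) * hξ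
  · refine (hr.const_mul Complex.I).cexp.congr_fderiv (ContinuousLinearMap.ext fun ξ => ?_)
    have hξ := Complex.re_add_im ξ
    simp [liftDeriv_apply, liftHorizontal, mulJ_lift, hconj]
    linear_combination (1 / 2) * Complex.I * Complex.exp (Complex.I * z.re) * hξ
  · refine ((hr.const_mul Complex.I).neg.cexp.const_mul Complex.I).congr_fderiv
      (ContinuousLinearMap.ext fun ξ => ?_)
    have hξ := Complex.re_add_im ξ
    simp [liftDeriv_apply, liftHorizontal, mulJ_lift, hconj]
    linear_combination (1 / 2) * Complex.exp (-(Complex.I * z.re)) * hξ -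
      Complex.exp (-(Complex.I * z.re)) * ξ.re * Complex.I_sq

theorem contDiff_lift : ContDiff ℝ ∞ lift := by
  have hr : ContDiff ℝ ∞ fun z : ℂ => (z.re : ℂ) :=
    (Complex.ofRealCLM.comp Complex.reCLM).contDiff
  have hi : ContDiff ℝ ∞ fun z : ℂ => (z.im : ℂ) :=
    (Complex.ofRealCLM.comp Complex.imCLM).contDiff
  refine (contDiff_piLp 2).2 fun j => ?_
  fin_cases j
  · exact (contDiff_const.mul hi).cexp
  · exact (contDiff_const.mul hi).neg.cexp
  · exact (contDiff_const.mul hr).cexp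
  · exact contDiff_const.mul (contDiff_const.mul hr).neg.cexp

/-! ## The curve -/

/-- The map from the torus to `ℂ⁴` induced by `lift`. -/
def torusLift (m : SquareTorus) : C4 :=
  !₂[(AddCircle.toCircle m.2 : ℂ), (AddCircle.toCircle (-m.2) : ℂ),
    (AddCircle.toCircle m.1 : ℂ), Complex.I * (AddCircle.toCircle (-m.1) : ℂ)]

theorem coe_toCircle_coe (x : ℝ) :
    (AddCircle.toCircle (x : AddCircle (2 * Real.pi)) : ℂ) = Complex.exp (Complex.I * x) := by
  rw [AddCircle.toCircle_apply_mk, div_self Real.two_pi_pos.ne', one_mul, Circle.coe_exp, mul_comm]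

/-- The formula through `toCircle` makes descent to the torus and continuity automatic; this
identity hands all differentiation over to `lift`. -/
theorem torusLift_mk (z : ℂ) : torusLift (SquareTorus.mk z) = lift z := by
  have hneg : ∀ x : ℝ, (AddCircle.toCircle (-(x : AddCircle (2 * Real.pi))) : ℂ) =
      Complex.exp (-(Complex.I * x)) := fun x => by
    rw [← AddCircle.coe_neg, coe_toCircle_coe]
    simp
  simp [torusLift, lift, SquareTorus.mk, coe_toCircle_coe, hneg]

theorem continuous_torusLift : Continuous torusLift := by
  have h1 : Continuous fun m : SquareTorus => (AddCircle.toCircle m.1 : ℂ) :=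
    continuous_subtype_val.comp (AddCircle.continuous_toCircle.comp continuous_fst)
  have h2 : Continuous fun m : SquareTorus => (AddCircle.toCircle m.2 : ℂ) :=
    continuous_subtype_val.comp (AddCircle.continuous_toCircle.comp continuous_snd)
  have h3 : Continuous fun m : SquareTorus => (AddCircle.toCircle (-m.1) : ℂ) :=
    continuous_subtype_val.comp (AddCircle.continuous_toCircle.comp continuous_fst.neg)
  have h4 : Continuous fun m : SquareTorus => (AddCircle.toCircle (-m.2) : ℂ) :=
    continuous_subtype_val.comp (AddCircle.continuous_toCircle.comp continuous_snd.neg)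
  refine (PiLp.continuous_toLp 2 _).comp (continuous_pi fun j => ?_)
  fin_cases j
  · exact h2
  · exact h4
  · exact h1
  · exact continuous_const.mul h3

theorem torusLift_ne_zero (m : SquareTorus) : torusLift m ≠ 0 := by
  obtain ⟨z, rfl⟩ := SquareTorus.mk_surjective m
  rw [torusLift_mk]
  exact lift_ne_zero z

/-- The pseudoholomorphic torus `x + iy ↦ [exp(iy), exp(-iy), exp(ix), i exp(-ix)]`. -/
def curve (m : SquareTorus) : CP3 := proj (torusLift m)

theorem continuous_curve : Continuous curve :=
  continuous_iff_continuousAt.2 fun m =>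
    (continuousAt_proj _ (torusLift_ne_zero m)).comp continuous_torusLift.continuousAt

theorem curve_mk (z : ℂ) :
    curve (SquareTorus.mk z) = Projectivization.mk ℂ (lift z) (lift_ne_zero z) := by
  rw [curve, torusLift_mk, proj_of_ne_zero]

theorem mk_chartAt (m : SquareTorus) : SquareTorus.mk (chartAt ℂ m m) = m :=
  chart_mem_atlas ℂ m m (mem_chart_source ℂ m)

theorem exists_rep_curve (m : SquareTorus) :
    ∃ a : ℂ, a ≠ 0 ∧ (curve m).rep = a • lift (chartAt ℂ m m) := by
  conv in curve m => rw [← mk_chartAt m, curve_mk]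
  exact rep_mk_eq _ _

/-- Inverse charts of the torus are restrictions of the covering, so in charts the curve is the lift
followed by affine coordinates. Smoothness and the differential both rest on this. -/
theorem affineCoord_curve_eventuallyEq (m : SquareTorus) (i : Fin 4) :
    (fun w : ℂ => affineCoord i (curve ((chartAt ℂ m).symm w)).rep) =ᶠ[nhds (chartAt ℂ m m)]
      fun w => affineCoord i (lift w) := by
  filter_upwards [(chartAt ℂ m).open_target.mem_nhds (mem_chart_target ℂ m)] with w hw
  rw [SquareTorus.mk_symm_apply (chart_mem_atlas ℂ m) hw, curve_mk, affineCoord_rep_mk]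

theorem contMDiff_curve : ContMDiff 𝓘(ℝ, ℂ) 𝓘(ℝ, C3) ∞ curve := by
  intro m
  refine contMDiffAt_iff.2 ⟨continuous_curve.continuousAt, ContDiffAt.contDiffWithinAt ?_⟩
  change ContDiffAt ℝ ∞ (fun w : ℂ =>
    affineCoord (chartIndex (curve m)) (curve ((chartAt ℂ m).symm w)).rep) (chartAt ℂ m m)
  refine ContDiffAt.congr_of_eventuallyEq ?_ (affineCoord_curve_eventuallyEq m _)
  have h : ContDiffAt ℝ ω (affineCoord (chartIndex (curve m))) (lift (chartAt ℂ m m)) :=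
    (contDiffOn_affineCoord _).contDiffAt
      ((isOpen_ne_fun (by fun_prop) continuous_const).mem_nhds (lift_apply_ne_zero _ _))
  exact (h.of_le (by simp)).comp _ contDiff_lift.contDiffAt

theorem hasMFDerivAt_curve (m : SquareTorus) :
    HasMFDerivAt 𝓘(ℝ, ℂ) 𝓘(ℝ, C3) curve m
      (((fderiv ℂ (affineCoord (chartIndex (curve m)))
        (lift (chartAt ℂ m m))).restrictScalars ℝ).comp (liftDeriv (chartAt ℂ m m)) :
          ℂ →L[ℝ] C3) := by
  refine ⟨continuous_curve.continuousAt, HasFDerivAt.hasFDerivWithinAt ?_⟩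
  have h := ((hasFDerivAt_affineCoord (chartIndex (curve m)) _
    (lift_apply_ne_zero (chartAt ℂ m m) _)).restrictScalars ℝ).comp _
      (hasFDerivAt_lift (chartAt ℂ m m))
  exact h.congr_of_eventuallyEq (affineCoord_curve_eventuallyEq m _)

theorem exists_mfderiv_curve (m : SquareTorus) : ∃ a : ℂ, a ≠ 0 ∧
    (curve m).rep = a • lift (chartAt ℂ m m) ∧
    ∀ ξ : ℂ, (mfderiv 𝓘(ℝ, ℂ) 𝓘(ℝ, C3) curve m ξ : C3) =
      dproj (curve m) (a • liftDeriv (chartAt ℂ m m) ξ) := by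
  obtain ⟨a, ha, hrep⟩ := exists_rep_curve m
  refine ⟨a, ha, hrep, fun ξ => ?_⟩
  rw [dproj_eq_fderiv, hrep, fderiv_affineCoord_smul _ _ (lift_apply_ne_zero _ _) a ha]
  exact congrArg (fun L : ℂ →L[ℝ] C3 => L ξ) (hasMFDerivAt_curve m).mfderiv

theorem isPseudoholomorphicCurve_curve : IsPseudoholomorphicCurve curve where
  smooth := contMDiff_curve
  nonconstant := by
    -- From `0` to `π` the first coordinate stays `1` while the third changes sign, so the lifts are
    -- not proportional.
    refine ⟨SquareTorus.mk 0, SquareTorus.mk Real.pi, fun h => ?_⟩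
    rw [curve_mk, curve_mk, Projectivization.mk_eq_mk_iff'] at h
    obtain ⟨a, ha⟩ := h
    have h0 := congrArg (fun v : C4 => v 0) ha
    have h2 := congrArg (fun v : C4 => v 2) ha
    simp [lift, mul_comm Complex.I, Complex.exp_pi_mul_I] at h0 h2
    rw [h0] at h2
    norm_num at h2
  commutes m ξ := by
    obtain ⟨a, ha, hrep, hd⟩ := exists_mfderiv_curve m
    have hq : quatLine (curve m).rep = quatLine (lift (chartAt ℂ m m)) := by
      rw [hrep, quatLine_smul a ha]
    have hh : a • ξ • liftHorizontal (chartAt ℂ m m) ∈ (quatLine (curve m).rep)ᗮ := by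
      rw [hq]
      exact Submodule.smul_mem _ _ (Submodule.smul_mem _ _ (liftHorizontal_mem _))
    have hv : a • (starRingEnd ℂ) ξ • (1 / 2 : ℂ) • mulJ (lift (chartAt ℂ m m)) ∈
        quatLine (curve m).rep := by
      rw [hq]
      exact Submodule.smul_mem _ _ (Submodule.smul_mem _ _ (Submodule.smul_mem _ _
        (mulJ_mem_quatLine _)))
    have h1 := hd (Complex.I * ξ)
    have h2 := (congrArg (J (curve m)) (hd ξ)).trans
      ((congrArg (fun w => J (curve m) (dproj (curve m) w))
        (by rw [liftDeriv_apply, smul_add])).trans (J_dproj_add (curve m) hh hv))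
    refine h1.trans (Eq.trans ?_ h2.symm)
    congr 1
    rw [liftDeriv_apply]
    -- Replacing `ξ` by `iξ` multiplies the conjugate-linear term by `-i`, exactly as `J` does on
    -- the vertical space.
    simp only [map_mul, Complex.conj_I]
    module

/-- Otherwise `liftHorizontal z` would lie both in the quaternionic line and in its orthogonal
complement, hence vanish; its first coordinate is half an exponential. -/
theorem not_isVertical_curve : ¬ IsVertical curve := by
  intro h
  obtain ⟨a, ha, hrep, hd⟩ := exists_mfderiv_curve (SquareTorus.mk 0)
  set z := chartAt ℂ (SquareTorus.mk 0) (SquareTorus.mk 0)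
  have h1 : dproj _ (a • liftDeriv z 1) ∈ vertical (curve (SquareTorus.mk 0)) := by
    have := h (SquareTorus.mk 0) 1
    rwa [hd] at this
  have h2 := mem_quatLine_of_dproj_mem_vertical h1
  rw [hrep, quatLine_smul a ha, Submodule.smul_mem_iff _ ha, liftDeriv_apply, map_one, one_smul,
    one_smul, Submodule.add_mem_iff_left _ (Submodule.smul_mem _ _ (mulJ_mem_quatLine _))] at h2
  have h3 := Submodule.disjoint_def.1 (Submodule.orthogonal_disjoint _) _ h2 (liftHorizontal_mem z)
  have h4 := congrArg (fun v : C4 => v 0) h3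
  simp [liftHorizontal, Complex.exp_ne_zero] at h4

/-- Otherwise the image of `mulJ (lift z)` would be both vertical and horizontal, hence zero, making
`mulJ (lift z)` a multiple `c • lift z`. The first coordinate gives `c = -1`, the second `c = 1`. -/
theorem not_isHorizontal_curve : ¬ IsHorizontal curve := by
  intro h
  obtain ⟨a, ha, hrep, hd⟩ := exists_mfderiv_curve (SquareTorus.mk 0)
  set z := chartAt ℂ (SquareTorus.mk 0) (SquareTorus.mk 0)
  have hq : quatLine (curve (SquareTorus.mk 0)).rep = quatLine (lift z) := by
    rw [hrep, quatLine_smul a ha]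
  have h1 : dproj _ (a • liftDeriv z 1) ∈ horizontal (curve (SquareTorus.mk 0)) := by
    have := h (SquareTorus.mk 0) 1
    rwa [hd] at this
  have h2 : dproj _ (a • liftHorizontal z) ∈ horizontal (curve (SquareTorus.mk 0)) :=
    ⟨_, hq ▸ Submodule.smul_mem _ _ (liftHorizontal_mem z), rfl⟩
  have h3 : dproj _ (a • mulJ (lift z)) ∈ vertical (curve (SquareTorus.mk 0)) :=
    ⟨_, hq ▸ Submodule.smul_mem _ _ (mulJ_mem_quatLine _), rfl⟩
  have h4 : dproj _ (a • mulJ (lift z)) ∈ horizontal (curve (SquareTorus.mk 0)) := by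
    -- Subtracting the horizontal term from the derivative at `ξ = 1` leaves half of `mulJ (lift
    -- z)`, up to `a`; the factor 2 clears the half.
    have h5 := Submodule.smul_mem _ (2 : ℂ) (Submodule.sub_mem _ h1 h2)
    rw [← map_sub, ← map_smul, liftDeriv_apply, map_one] at h5
    convert h5 using 2
    module
  have h6 := Submodule.disjoint_def.1 (isCompl_vertical_horizontal _).disjoint _ h3 h4
  obtain ⟨c, hc⟩ := dproj_eq_zero _ _ h6
  rw [hrep, mulJ_lift] at hc
  have e0 := congrArg (fun v : C4 => v 0) hc
  have e1 := congrArg (fun v : C4 => v 1) hc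
  have hy := Complex.exp_ne_zero (Complex.I * z.im)
  have hy' := Complex.exp_ne_zero (-(Complex.I * z.im))
  simp only [lift, PiLp.smul_apply, smul_eq_mul] at e0 e1
  simp only [Matrix.cons_val] at e0 e1
  have f0 : a * (1 + c) = 0 := by
    refine (mul_eq_zero.1 (?_ : _ * Complex.exp (Complex.I * z.im) = 0)).resolve_right hy
    linear_combination -e0
  have f1 : a * (1 - c) = 0 := by
    refine (mul_eq_zero.1 (?_ : _ * Complex.exp (-(Complex.I * z.im)) = 0)).resolve_right hy'
    linear_combination e1
  exact ha (by linear_combination (f0 + f1) / 2)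

end NearlyKahlerCP3

end

theorem mainTheorem4 :
    ∃ (M : Type) (_ : TopologicalSpace M) (_ : ChartedSpace ℂ M) (X : M → NearlyKahlerCP3.CP3),
      IsManifold 𝓘(ℂ, ℂ) ω M ∧ T2Space M ∧ CompactSpace M ∧ ConnectedSpace M ∧
      NearlyKahlerCP3.IsPseudoholomorphicCurve X ∧
      ¬ NearlyKahlerCP3.IsVertical X ∧ ¬ NearlyKahlerCP3.IsHorizontal X :=
  ⟨NearlyKahlerCP3.SquareTorus, inferInstance, inferInstance, NearlyKahlerCP3.curve,
    inferInstance, inferInstance, inferInstance, inferInstance,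
    NearlyKahlerCP3.isPseudoholomorphicCurve_curve, NearlyKahlerCP3.not_isVertical_curve,
    NearlyKahlerCP3.not_isHorizontal_curve⟩
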